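/- **Setting.** An instance of the polytope scheduling problem (PSP) has $n$ jobs, all available at time $0$, with processing requirements $p_j>0$ and predictions $\hat p_j$ with $0<\hat p_j\le p_j$, and a (bounded) polytope $\mathcal P=\{y\in\mathbb R^n_{\ge 0}: By\le \mathbf 1\}$ with $B\in\mathbb R_{\ge 0}^{D\times n}$. A feasible schedule chooses (measurably) at each time $t\ge 0$ a rate vector $y(t)\in\mathcal P$; job $j$ completes at the earliest time $C_j$ with $\int_0^{C_j}y_j(t)\,dt\ge p_j$, and $\mathrm{opt}$ is the infimum of $\sum_j C_j$ over all feasible schedules. The meaning of preemption depends on the concrete scheduling problem: it comes with a nonempty set of configurations, each of which processes the jobs with some rate vector in $\mathcal P$, and with a rule telling, for each job and each pair of different configurations, whether switching from the first to the second preempts the job. An executed schedule is a finite sequence of configurations, each held for a positive time; the preemptions of job $j$ in it are the switches at which $j$ is being processed (has positive rate), is unfinished, and is preempted according to the rule. A procedure for computing $\alpha$-approximate $c$-preemptive schedules maps every $y\in\mathcal P$ and every length $l>0$ to an executed schedule that processes each job $j$ for exactly its requirement $l y_j$, has makespan at most $\alpha l$, and preempts each job at most $c$ times. An online algorithm is non-clairvoyant: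 it knows the problem, the procedure and the predictions $\hat p_j$, but of the requirements $p_j$ it learns only which jobs have completed so far. **Theorem.** For every $c\in\mathbb N$ there is a constant $K>0$ depending only on $c$ such that the following holds. Suppose that for a PSP with a notion of preemption as above a procedure for computing $\alpha$-approximate $c$-preemptive schedules is given. Then for every $\varepsilon>0$ there is a non-clairvoyant online algorithm that, for all requirements $p$ and predictions $\hat p$ with $0<\hat p_j\le p_j$ for all $j$, completes all jobs with $$\sum_j C_j\le 27\,\alpha\,(1+\varepsilon)\cdot \mathrm{opt}$$ and performs in total at most $$K\cdot\max\{1,\varepsilon^{-3}\}\cdot\sum_j\Bigl(1+\log_2\frac{p_j}{\hat p_j}\Bigr)$$ preemptions. -/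

import Mathlib

open scoped ENNReal NNReal

noncomputable section

namespace PSP

universe u

/-- A rate polytope `{y ≥ 0 | B y ≤ 1}` for `n` jobs, with `B` entrywise nonnegative. The field
`column` says that no column of `B` vanishes, which is the same as boundedness of the polytope. -/
structure RatePolytope (n : ℕ) where
  /-- number of packing constraints -/
  D : ℕ
  /-- constraint matrix -/
  B : Matrix (Fin D) (Fin n) ℝ
  nonneg : ∀ d j, 0 ≤ B d j
  column : ∀ j, ∃ d, 0 < B d j

/-- The set of feasible rate vectors. -/
def RatePolytope.rates {n : ℕ} (P : RatePolytope n) : Set (Fin n → ℝ) :=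
  {y | (∀ j, 0 ≤ y j) ∧ ∀ d, (P.B.mulVec y) d ≤ 1}

/-- A (fractional) schedule: a measurable choice, at every time `t ≥ 0`, of a rate vector in the
polytope. (All jobs are released at time `0`.) -/
def RatePolytope.Feasible {n : ℕ} (P : RatePolytope n) (y : ℝ → Fin n → ℝ) : Prop :=
  Measurable y ∧ ∀ t, 0 ≤ t → y t ∈ P.rates

/-- The completion time of job `j` under the rates `y`: the earliest time by which it has received
`p j` units of processing (`∞` if this never happens). Rates given to `j` later have no effect. -/
def completionTime {n : ℕ} (y : ℝ → Fin n → ℝ) (p : Fin n → ℝ) (j : Fin n) : ℝ≥0∞ :=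
  ⨅ (t : ℝ≥0) (_ : p j ≤ ∫ s in (0 : ℝ)..t, y s j), (t : ℝ≥0∞)

/-- The total completion time of the rates `y`. -/
def totalCompletionTime {n : ℕ} (y : ℝ → Fin n → ℝ) (p : Fin n → ℝ) : ℝ≥0∞ :=
  ∑ j, completionTime y p j

/-- The offline optimum of polytope scheduling: the infimum of the total completion time over all
feasible schedules. -/
def RatePolytope.opt {n : ℕ} (P : RatePolytope n) (p : Fin n → ℝ) : ℝ≥0∞ :=
  ⨅ (y : ℝ → Fin n → ℝ) (_ : P.Feasible y), totalCompletionTime y p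

/-- A polytope scheduling problem together with its own notion of preemption.

What counts as a preemption depends on the concrete scheduling problem that the polytope stands
for, and in general it cannot be read off from the rates alone (a job may migrate between two
machines of equal speed). So a problem comes with the set `Config` of the instantaneous
configurations of the system (for instance assignments of jobs to machines), each of which processes
the jobs with a rate vector of the polytope, and with the rule `Preempts j ω ω'` telling whether a
switch from `ω` to `ω'` changes the treatment of a job `j`, in process and unfinished, in a way that
counts as a preemption (interruption, migration, change of the rate, ...). Remaining in the same
configuration preempts nobody. For preemptions in the sense of rate changes, take for `Config` the
polytope itself and for `Preempts j y y'` the relation `y j ≠ y' j`. -/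
structure Problem (n : ℕ) extends RatePolytope n where
  Config : Type u
  nonempty : Nonempty Config
  rate : Config → Fin n → ℝ
  rate_mem : ∀ ω, rate ω ∈ toRatePolytope.rates
  Preempts : Fin n → Config → Config → Prop
  irrefl : ∀ j ω, ¬ Preempts j ω ω

/-- A period of length `len` during which the system stays in one configuration. An executed
schedule is a list of such segments, in chronological order. -/
structure Segment (Ω : Type u) where
  config : Ω
  len : ℝ

variable {n : ℕ}

/-- The rates of an executed schedule as a function of time (zero after its end). -/
def Problem.rateAt (S : Problem.{u} n) : List (Segment S.Config) → ℝ → Fin n → ℝ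
  | [], _ => 0
  | s :: σ, t => if t < s.len then S.rate s.config else S.rateAt σ (t - s.len)

/-- The total amount of processing that job `j` receives. -/
def Problem.processed (S : Problem.{u} n) (σ : List (Segment S.Config)) (j : Fin n) : ℝ :=
  (σ.map fun s => s.len * S.rate s.config j).sum

/-- The length of an executed schedule. -/
def Problem.makespan (S : Problem.{u} n) (σ : List (Segment S.Config)) : ℝ :=
  (σ.map Segment.len).sum

open Classical in
/-- The number of preemptions of job `j` in an executed schedule when its (remaining) processing
requirement is `r`: the number of switches between consecutive segments at which `j` is in process,
is not yet finished, and is preempted according to the rule of the problem. -/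
def Problem.preemptions (S : Problem.{u} n) (j : Fin n) : ℝ → List (Segment S.Config) → ℕ
  | _, [] => 0
  | _, [_] => 0
  | r, s :: s' :: σ =>
      (if 0 < S.rate s.config j ∧ s.len * S.rate s.config j < r ∧
          S.Preempts j s.config s'.config then 1 else 0) +
        S.preemptions j (r - s.len * S.rate s.config j) (s' :: σ)

/-- `σ` is an `α`-approximate schedule with at most `c` preemptions per job for the schedule of
length `l` with fixed allocation `y`: it processes every job `j` for its requirement `l * y j`,
has makespan at most `α * l`, and preempts each job at most `c` times. -/
structure Problem.IsApproxPreemptive (S : Problem.{u} n) (α : ℝ) (c : ℕ) (y : Fin n → ℝ) (l : ℝ)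
    (σ : List (Segment S.Config)) : Prop where
  len_pos : ∀ s ∈ σ, 0 < s.len
  processed_eq : ∀ j, S.processed σ j = l * y j
  makespan_le : S.makespan σ ≤ α * l
  preemptions_le : ∀ j, S.preemptions j (l * y j) σ ≤ c

/-- A procedure for computing `α`-approximate schedules with at most `c` preemptions per job: it
turns every allocation `y` of the polytope and every length `l > 0` into such a schedule. -/
def Problem.IsProcedure (S : Problem.{u} n) (α : ℝ) (c : ℕ)
    (proc : (Fin n → ℝ) → ℝ → List (Segment S.Config)) : Prop :=
  ∀ y ∈ S.rates, ∀ l : ℝ, 0 < l → S.IsApproxPreemptive α c y l (proc y l)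

open Classical in
/-- The jobs with requirements `p` that are finished after the executed schedule `σ`. -/
def Problem.finished (S : Problem.{u} n) (p : Fin n → ℝ) (σ : List (Segment S.Config)) :
    Finset (Fin n) :=
  Finset.univ.filter fun j => p j ≤ S.processed σ j

/-- A decision of an online algorithm: put the system into the configuration `config` for
`duration` units of time; if `wake` is set, the algorithm is woken up earlier should an unfinished
job complete before. -/
structure Decision (Ω : Type u) where
  config : Ω
  duration : ℝ
  duration_pos : 0 < duration
  wake : Bool

/-- What an online algorithm sees of the past: the executed segments, and after each of them the
set of the jobs finished by then. -/
abbrev Problem.History (S : Problem.{u} n) : Type u :=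
  List (Segment S.Config × Finset (Fin n))

/-- A (deterministic) non-clairvoyant online algorithm with predictions for the problem `S`: from
the predicted requirements and the observed history it determines its next decision. It has no
access to the true requirements. -/
abbrev Problem.Algorithm (S : Problem.{u} n) : Type u :=
  (Fin n → ℝ) → S.History → Decision S.Config

/-- The executed schedule recorded in a history. -/
def Problem.executed (S : Problem.{u} n) (h : S.History) : List (Segment S.Config) :=
  h.map Prod.fst

open Classical in
/-- The time for which a decision is in force if the true requirements are `p`: its duration, or,
if `wake` is set, the time until the first completion of an unfinished job if that is smaller. -/
def Problem.elapsed (S : Problem.{u} n) (p : Fin n → ℝ) (σ : List (Segment S.Config))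
    (a : Decision S.Config) : ℝ :=
  if a.wake then
    (insert a.duration
      ((Finset.univ.filter fun j => S.processed σ j < p j ∧ 0 < S.rate a.config j).image
        fun j => (p j - S.processed σ j) / S.rate a.config j)).min' (Finset.insert_nonempty _ _)
  else a.duration

/-- The history after `N` decisions of the algorithm `A` with predictions `phat` when the true
requirements are `p`. -/
def Problem.run (S : Problem.{u} n) (A : S.Algorithm) (phat p : Fin n → ℝ) : ℕ → S.History
  | 0 => []
  | N + 1 =>
      let h := S.run A phat p N
      let a := A phat h
      let s : Segment S.Config := ⟨a.config, S.elapsed p (S.executed h) a⟩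
      h ++ [(s, S.finished p (S.executed h ++ [s]))]

/-- The schedule executed in the first `N` decisions. -/
def Problem.schedule (S : Problem.{u} n) (A : S.Algorithm) (phat p : Fin n → ℝ) (N : ℕ) :
    List (Segment S.Config) :=
  S.executed (S.run A phat p N)

/-- Executed schedules are feasible schedules of the polytope scheduling problem. -/
theorem Problem.feasible_rateAt (S : Problem.{u} n) (σ : List (Segment S.Config)) :
    S.Feasible (S.rateAt σ) := by
  refine ⟨?_, fun t _ => ?_⟩
  · induction σ with
    | nil => exact measurable_const
    | cons s σ ih =>
      exact Measurable.ite measurableSet_Iio measurable_const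
        (ih.comp (measurable_id.sub_const s.len))
  · induction σ generalizing t with
    | nil =>
      refine ⟨fun j => le_rfl, fun d => ?_⟩
      simp [Problem.rateAt]
    | cons s σ ih =>
      rw [Problem.rateAt]
      split_ifs with hlt
      · exact S.rate_mem _
      · exact ih _ (by linarith)

end PSP

end

/-!
The algorithm works in phases of lengths `T k`, growing by the factor `3 / 2`. In phase `k` it lets
the procedure execute, for the length `T k`, the proportionally fair rates `y` of the set `U k` of
the jobs unfinished at the start of the phase, except that a job `j` for which `T k * y j` is less
than `1 / 30` of the maximum of its current amount and its prediction is left out. Phases without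
any job are skipped. The requirements enter only through the sets `U k`, which the algorithm
observes.

Competitive ratio. Fairness says `∑ j ∈ U k, z j / y j ≤ |U k|` for every `z` in the polytope
(`PSP.RatePolytope.sum_div_fair_le`). A job that survives phase `k` satisfies
`T k * y j ≤ 31 / 30 * p j`, no matter whether it was left out, because predictions are lower bounds
on the requirements. Applied to the average rates of an arbitrary schedule up to time `τ`, fairness
therefore shows that at most `31 / 30 * |U k| * τ / T k` of the jobs in `U (k + 1)` are completed by
that schedule before `τ` (`PSP.RatePolytope.Feasible.card_mul_le`). So the other schedule, too, has
many unfinished jobs at the times around `7 / 20 * T k`. These times grow geometrically, hence the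
resulting bounds on its total completion time can be added up, and they give
`∑ k, T k * |U k| ≤ 27 * opt` (`PSP.RatePolytope.sum_phaseLength_mul_card_le`). As the procedure
stretches each phase by at most `α`, the total completion time of the algorithm is at most
`α * ∑ k, T k * |U k|`. No loss of `1 + ε` occurs, so one algorithm serves all `ε`.

Preemptions. Each phase that processes a job multiplies one plus the ratio of its amount and its
prediction by at least `61 / 60`, so that the job takes part in `O(1 + log (p j / phat j))` phases
(`PSP.RatePolytope.participations_mul_le`). Each of them preempts the job at most `c` times by the
guarantee of the procedure, and once more when the job has got its share of the phase
(`PSP.Problem.preemptions_append_le`).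
-/

noncomputable section

namespace PSP

variable {n : ℕ}

/-! ### The rate polytope and proportionally fair rates -/

namespace RatePolytope

variable (P : RatePolytope n)

theorem rates_of_le {y z : Fin n → ℝ} (hz : z ∈ P.rates) (h0 : ∀ j, 0 ≤ y j)
    (h : ∀ j, y j ≤ z j) : y ∈ P.rates := by
  refine ⟨h0, fun d => le_trans ?_ (hz.2 d)⟩
  simp only [Matrix.mulVec, dotProduct]
  exact Finset.sum_le_sum fun j _ => mul_le_mul_of_nonneg_left (h j) (P.nonneg d j)

theorem zero_mem_rates : (0 : Fin n → ℝ) ∈ P.rates :=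
  ⟨fun _ => le_rfl, fun d => by simp⟩

theorem exists_rate_bound : ∃ b : ℝ, 0 < b ∧ ∀ y ∈ P.rates, ∀ j, y j ≤ b := by
  choose d hd using P.column
  refine ⟨1 + ∑ j, (P.B (d j) j)⁻¹, ?_, fun y hy j => ?_⟩
  · have : 0 ≤ ∑ j, (P.B (d j) j)⁻¹ := Finset.sum_nonneg fun j _ => (inv_pos.2 (hd j)).le
    linarith
  · have h1 : P.B (d j) j * y j ≤ 1 := by
      refine le_trans ?_ (hy.2 (d j))
      exact Finset.single_le_sum (f := fun i => P.B (d j) i * y i)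
        (fun i _ => mul_nonneg (P.nonneg _ _) (hy.1 i)) (Finset.mem_univ j)
    have h2 : y j ≤ (P.B (d j) j)⁻¹ := by
      rw [← one_div, le_div_iff₀ (hd j)]
      linarith
    have h3 : (P.B (d j) j)⁻¹ ≤ ∑ i, (P.B (d i) i)⁻¹ :=
      Finset.single_le_sum (f := fun i => (P.B (d i) i)⁻¹)
        (fun i _ => (inv_pos.2 (hd i)).le) (Finset.mem_univ j)
    linarith

/-- An upper bound on all coordinates of the rate vectors of the polytope. -/
def rateBound : ℝ := P.exists_rate_bound.choose

theorem rateBound_pos : 0 < P.rateBound := P.exists_rate_bound.choose_spec.1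

theorem le_rateBound {y : Fin n → ℝ} (hy : y ∈ P.rates) (j : Fin n) : y j ≤ P.rateBound :=
  P.exists_rate_bound.choose_spec.2 y hy j

theorem isCompact_rates : IsCompact P.rates := by
  have hclosed : IsClosed P.rates := by
    have : P.rates = (⋂ j, {y | 0 ≤ y j}) ∩ ⋂ d, {y | (P.B.mulVec y) d ≤ 1} := by
      ext y; simp [rates]
    rw [this]
    refine (isClosed_iInter fun j => isClosed_le continuous_const (continuous_apply j)).inter
      (isClosed_iInter fun d => isClosed_le ?_ continuous_const)
    exact (continuous_apply d).comp (Continuous.matrix_mulVec continuous_const continuous_id)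
  refine (isCompact_Icc (a := (0 : Fin n → ℝ)) (b := fun _ => P.rateBound)).of_isClosed_subset
    hclosed fun y hy => ⟨fun j => hy.1 j, fun j => P.le_rateBound hy j⟩

theorem exists_pos_mem_rates : ∃ y ∈ P.rates, ∀ j, 0 < y j := by
  have hB : 0 ≤ ∑ d, ∑ j, P.B d j :=
    Finset.sum_nonneg fun d _ => Finset.sum_nonneg fun j _ => P.nonneg d j
  have hpos : 0 < (1 + ∑ d, ∑ j, P.B d j)⁻¹ := inv_pos.2 (by linarith)
  refine ⟨fun _ => (1 + ∑ d, ∑ j, P.B d j)⁻¹, ⟨fun _ => hpos.le, fun d => ?_⟩, fun _ => hpos⟩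
  have h1 : ∑ j, P.B d j ≤ ∑ d, ∑ j, P.B d j :=
    Finset.single_le_sum (f := fun d => ∑ j, P.B d j)
      (fun d _ => Finset.sum_nonneg fun j _ => P.nonneg d j) (Finset.mem_univ d)
  simp only [Matrix.mulVec, dotProduct]
  rw [← Finset.sum_mul, ← div_eq_mul_inv, div_le_one (by linarith)]
  linarith

/-- Existence of the proportionally fair rates for a set `U` of jobs. They maximize the product of
the rates of `U`, and the last claim is the first-order optimality condition. -/
theorem exists_fair (U : Finset (Fin n)) :
    ∃ y ∈ P.rates, (∀ j ∈ U, 0 < y j) ∧ (∀ j ∉ U, y j = 0) ∧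
      ∀ z ∈ P.rates, ∑ j ∈ U, z j / y j ≤ U.card := by
  classical
  obtain ⟨y₀, hy₀, hpos₀⟩ := P.exists_pos_mem_rates
  obtain ⟨y, hy, hmax⟩ := P.isCompact_rates.exists_isMaxOn ⟨y₀, hy₀⟩
    (f := fun y : Fin n → ℝ => ∏ j ∈ U, y j)
    (Continuous.continuousOn (continuous_finsetProd _ fun j _ => continuous_apply j))
  have hprod : 0 < ∏ j ∈ U, y j :=
    (Finset.prod_pos fun j _ => hpos₀ j).trans_le (hmax hy₀)
  have hypos : ∀ j ∈ U, 0 < y j := fun j hj =>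
    (hy.1 j).lt_of_ne' fun h => hprod.ne' (Finset.prod_eq_zero hj h)
  have hfoc : ∀ z ∈ P.rates, ∑ j ∈ U, z j / y j ≤ U.card := by
    intro z hz
    have hconv : ∀ t : ℝ, 0 < t → t < 1 → (fun j => y j + t * (z j - y j)) ∈ P.rates := by
      intro t ht ht1
      have e : (fun j => y j + t * (z j - y j)) = (1 - t) • y + t • z := by
        ext j; simp; ring
      refine ⟨fun j => ?_, fun d => ?_⟩
      · have := mul_nonneg (sub_nonneg.2 ht1.le) (hy.1 j)
        have := mul_nonneg ht.le (hz.1 j)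
        linarith
      · rw [e, Matrix.mulVec_add, Matrix.mulVec_smul, Matrix.mulVec_smul]
        have h1 := mul_le_mul_of_nonneg_left (hy.2 d) (sub_nonneg.2 ht1.le)
        have h2 := mul_le_mul_of_nonneg_left (hz.2 d) ht.le
        simp only [Pi.add_apply, Pi.smul_apply, smul_eq_mul]
        linarith
    have hder : HasDerivAt (fun t : ℝ => ∑ j ∈ U, Real.log (y j + t * (z j - y j)))
        (∑ j ∈ U, (z j - y j) / y j) 0 := by
      refine HasDerivAt.fun_sum fun j hj => ?_
      have h1 : HasDerivAt (fun t : ℝ => y j + t * (z j - y j)) (z j - y j) 0 := by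
        simpa using ((hasDerivAt_id (0 : ℝ)).mul_const (z j - y j)).const_add (y j)
      simpa using h1.log (by simpa using (hypos j hj).ne')
    have hle : ∑ j ∈ U, (z j - y j) / y j ≤ 0 := by
      refine le_of_tendsto hder.tendsto_slope_zero_right ?_
      have h1 : ∀ᶠ t : ℝ in nhdsWithin 0 (Set.Ioi 0), ∀ j ∈ U, 0 < y j + t * (z j - y j) := by
        rw [Filter.eventually_all_finset]
        intro j hj
        have hc : Filter.Tendsto (fun t : ℝ => y j + t * (z j - y j)) (nhds 0)
            (nhds (y j + 0 * (z j - y j))) := by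
          apply Continuous.tendsto
          fun_prop
        exact (hc.mono_left nhdsWithin_le_nhds).eventually_const_lt (by simpa using hypos j hj)
      filter_upwards [h1, Ioo_mem_nhdsGT (zero_lt_one' ℝ)] with t ht ht01
      have hm := hmax (hconv t ht01.1 ht01.2)
      have hlog := Real.log_le_log (Finset.prod_pos ht) hm
      rw [Real.log_prod (fun j hj => (ht j hj).ne'),
        Real.log_prod (fun j hj => (hypos j hj).ne')] at hlog
      have : 0 ≤ t⁻¹ := (inv_pos.2 ht01.1).le
      simp only [smul_eq_mul, zero_add, zero_mul, add_zero]
      exact mul_nonpos_of_nonneg_of_nonpos this (by linarith)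
    have : ∑ j ∈ U, (z j - y j) / y j = ∑ j ∈ U, z j / y j - U.card := by
      rw [Finset.card_eq_sum_ones, Nat.cast_sum, ← Finset.sum_sub_distrib]
      refine Finset.sum_congr rfl fun j hj => ?_
      rw [sub_div, div_self (hypos j hj).ne', Nat.cast_one]
    linarith
  refine ⟨fun j => if j ∈ U then y j else 0, ?_, ?_, ?_, ?_⟩
  · refine P.rates_of_le hy (fun j => ?_) fun j => ?_ <;> split_ifs
    exacts [hy.1 j, le_rfl, le_rfl, hy.1 j]
  · intro j hj
    simpa [hj] using hypos j hj
  · intro j hj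
    simp [hj]
  · intro z hz
    refine le_trans (le_of_eq (Finset.sum_congr rfl fun j hj => ?_)) (hfoc z hz)
    simp [hj]

/-- The proportionally fair rates for the set `U` of jobs. -/
def fair (U : Finset (Fin n)) : Fin n → ℝ := (P.exists_fair U).choose

theorem fair_mem (U : Finset (Fin n)) : P.fair U ∈ P.rates := (P.exists_fair U).choose_spec.1

theorem fair_pos {U : Finset (Fin n)} {j : Fin n} (hj : j ∈ U) : 0 < P.fair U j :=
  (P.exists_fair U).choose_spec.2.1 j hj

theorem fair_eq_zero {U : Finset (Fin n)} {j : Fin n} (hj : j ∉ U) : P.fair U j = 0 :=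
  (P.exists_fair U).choose_spec.2.2.1 j hj

theorem sum_div_fair_le (U : Finset (Fin n)) {z : Fin n → ℝ} (hz : z ∈ P.rates) :
    ∑ j ∈ U, z j / P.fair U j ≤ U.card :=
  (P.exists_fair U).choose_spec.2.2.2 z hz

/-! ### Feasible schedules -/

variable {P} {y : ℝ → Fin n → ℝ}

theorem Feasible.intervalIntegrable (hy : P.Feasible y) (j : Fin n) {s t : ℝ} (hs : 0 ≤ s)
    (hst : s ≤ t) : IntervalIntegrable (fun u => y u j) MeasureTheory.volume s t := by
  rw [intervalIntegrable_iff_integrableOn_Ioc_of_le hst]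
  refine MeasureTheory.IntegrableOn.of_bound (by simp)
    ((measurable_pi_apply j).comp hy.1).aestronglyMeasurable P.rateBound ?_
  filter_upwards [MeasureTheory.ae_restrict_mem measurableSet_Ioc] with u hu
  have hu0 : 0 ≤ u := hs.trans hu.1.le
  rw [Real.norm_of_nonneg ((hy.2 u hu0).1 j)]
  exact P.le_rateBound (hy.2 u hu0) j

theorem Feasible.integral_mono (hy : P.Feasible y) (j : Fin n) {s t : ℝ} (hs : 0 ≤ s)
    (hst : s ≤ t) : ∫ u in (0 : ℝ)..s, y u j ≤ ∫ u in (0 : ℝ)..t, y u j := by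
  rw [← intervalIntegral.integral_add_adjacent_intervals (hy.intervalIntegrable j le_rfl hs)
    (hy.intervalIntegrable j hs hst)]
  have : 0 ≤ ∫ u in s..t, y u j :=
    intervalIntegral.integral_nonneg hst fun u hu => (hy.2 u (hs.trans hu.1)).1 j
  linarith

theorem Feasible.integral_le (hy : P.Feasible y) (j : Fin n) {t : ℝ} (ht : 0 ≤ t) :
    ∫ u in (0 : ℝ)..t, y u j ≤ t * P.rateBound := by
  have := intervalIntegral.integral_mono_on ht (hy.intervalIntegrable j le_rfl ht)
    intervalIntegrable_const (fun u hu => P.le_rateBound (hy.2 u hu.1) j)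
  simpa using this

theorem Feasible.average_mem (hy : P.Feasible y) {t : ℝ} (ht : 0 < t) :
    (fun j => (∫ u in (0 : ℝ)..t, y u j) / t) ∈ P.rates := by
  refine ⟨fun j => div_nonneg
    (intervalIntegral.integral_nonneg ht.le fun u hu => (hy.2 u hu.1).1 j) ht.le, fun d => ?_⟩
  have hint : ∀ j ∈ Finset.univ,
      IntervalIntegrable (fun u => P.B d j * y u j) MeasureTheory.volume 0 t :=
    fun j _ => (hy.intervalIntegrable j le_rfl ht.le).const_mul _
  have h1 : ∫ u in (0 : ℝ)..t, ∑ j, P.B d j * y u j ≤ ∫ _ in (0 : ℝ)..t, (1 : ℝ) := by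
    refine intervalIntegral.integral_mono_on ht.le ?_ intervalIntegrable_const
      fun u hu => (hy.2 u hu.1).2 d
    have e : (fun u => ∑ j, P.B d j * y u j) = ∑ j, fun u => P.B d j * y u j := by
      ext u; simp
    exact e ▸ IntervalIntegrable.sum Finset.univ hint
  rw [intervalIntegral.integral_finsetSum hint] at h1
  simp only [intervalIntegral.integral_const_mul, intervalIntegral.integral_const, sub_zero,
    smul_eq_mul, mul_one] at h1
  simp only [Matrix.mulVec, dotProduct]
  simp_rw [mul_div_assoc']
  rw [← Finset.sum_div, div_le_one ht]
  exact h1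

theorem Feasible.le_integral_of_completionTime_lt (hy : P.Feasible y) {p : Fin n → ℝ} {j : Fin n}
    {τ : ℝ} (h : completionTime y p j < ENNReal.ofReal τ) :
    p j ≤ ∫ u in (0 : ℝ)..τ, y u j := by
  simp only [completionTime, iInf_lt_iff] at h
  obtain ⟨t, ht, hlt⟩ := h
  refine ht.trans (hy.integral_mono j t.2 ?_)
  rw [ENNReal.ofReal, ENNReal.coe_lt_coe] at hlt
  exact (Real.lt_toNNReal_iff_coe_lt.1 hlt).le

theorem Feasible.le_completionTime (hy : P.Feasible y) (p : Fin n → ℝ) (j : Fin n) :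
    ENNReal.ofReal (p j / P.rateBound) ≤ completionTime y p j := by
  refine le_iInf₂ fun t ht => ?_
  rw [← ENNReal.ofReal_coe_nnreal]
  refine ENNReal.ofReal_le_ofReal ?_
  rw [div_le_iff₀ P.rateBound_pos]
  exact ht.trans (hy.integral_le j t.2)

/-- Comparison of an arbitrary schedule with the fair rates: if running the fair rates of `U` for
the time `T` gives each job of `X ⊆ U` at most `κ` times its requirement, then the jobs of `X` that
a feasible schedule completes before time `τ` are at most a `κ * τ / T` fraction of `U`. -/
theorem Feasible.card_mul_le (hy : P.Feasible y) {p : Fin n → ℝ} {U X : Finset (Fin n)}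
    (hX : X ⊆ U) {T τ κ : ℝ} (hτ : 0 < τ) (hκ : 0 < κ)
    (hp : ∀ j ∈ X, T * P.fair U j ≤ κ * p j)
    (hC : ∀ j ∈ X, completionTime y p j < ENNReal.ofReal τ) :
    X.card * T ≤ κ * U.card * τ := by
  have hz := hy.average_mem hτ
  have h1 := P.sum_div_fair_le U hz
  have h2 : ∑ _j ∈ X, T / (κ * τ) ≤ ∑ j ∈ U, (∫ u in (0 : ℝ)..τ, y u j) / τ / P.fair U j := by
    refine le_trans (Finset.sum_le_sum fun j hj => ?_)
      (Finset.sum_le_sum_of_subset_of_nonneg hX fun j _ _ =>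
        div_nonneg (hz.1 j) ((P.fair_mem U).1 j))
    have hf := P.fair_pos (hX hj)
    rw [div_div, div_le_div_iff₀ (mul_pos hκ hτ) (mul_pos hτ hf)]
    have h3 := hy.le_integral_of_completionTime_lt (hC j hj)
    have h4 := hp j hj
    have h5 := mul_le_mul_of_nonneg_left h3 hκ.le
    nlinarith
  have h3 := h2.trans h1
  rw [Finset.sum_const, nsmul_eq_mul, mul_div_assoc', div_le_iff₀ (mul_pos hκ hτ)] at h3
  linarith

end RatePolytope

/-! ### Phases of geometrically growing length -/

/-- The jobs with requirements `p` that are unfinished after receiving the amounts `e`. -/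
def unfinished (p e : Fin n → ℝ) : Finset (Fin n) :=
  Finset.univ.filter fun j => e j < p j

theorem mem_unfinished {p e : Fin n → ℝ} {j : Fin n} : j ∈ unfinished p e ↔ e j < p j := by
  simp [unfinished]

namespace RatePolytope

variable (P : RatePolytope n)

/-- The rates used in a phase of length `T` if the jobs have received the amounts `e` before and
`U` is the set of unfinished jobs: the fair rates, except that a job is left out if the phase would
not increase its amount by a constant fraction of the larger of its current amount and its
prediction. -/
def thresholdRates (phat : Fin n → ℝ) (T : ℝ) (e : Fin n → ℝ) (U : Finset (Fin n)) :
    Fin n → ℝ := fun j =>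
  if 1 / 30 * max (e j) (phat j) ≤ T * P.fair U j then P.fair U j else 0

/-- The length of phase `k`. The first phase is so short that no schedule can complete a job
before twice its length. -/
def phaseLength (phat : Fin n → ℝ) (k : ℕ) : ℝ :=
  (3 / 2) ^ k * (1 / (2 * P.rateBound * (1 + ∑ j, (phat j)⁻¹)))

/-- The amounts that the jobs have received before phase `k` if their requirements are `p`. -/
def amount (phat p : Fin n → ℝ) : ℕ → Fin n → ℝ
  | 0 => 0
  | k + 1 => fun j => amount phat p k j + P.phaseLength phat k *
      P.thresholdRates phat (P.phaseLength phat k) (amount phat p k)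
        (unfinished p (amount phat p k)) j

/-- The jobs with requirements `p` that are unfinished at the beginning of phase `k`. -/
def alive (phat p : Fin n → ℝ) (k : ℕ) : Finset (Fin n) := unfinished p (P.amount phat p k)

/-- The rates used in phase `k` if the requirements are `p`. -/
def phaseRates (phat p : Fin n → ℝ) (k : ℕ) : Fin n → ℝ :=
  P.thresholdRates phat (P.phaseLength phat k) (P.amount phat p k) (P.alive phat p k)

theorem thresholdRates_mem (phat : Fin n → ℝ) (T : ℝ) (e : Fin n → ℝ) (U : Finset (Fin n)) :
    P.thresholdRates phat T e U ∈ P.rates := by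
  refine P.rates_of_le (P.fair_mem U) (fun j => ?_) fun j => ?_ <;>
    unfold thresholdRates <;> split_ifs
  exacts [(P.fair_mem U).1 j, le_rfl, le_rfl, (P.fair_mem U).1 j]

variable {phat p : Fin n → ℝ}

theorem phaseRates_mem (k : ℕ) : P.phaseRates phat p k ∈ P.rates := P.thresholdRates_mem _ _ _ _

theorem amount_succ (k : ℕ) (j : Fin n) : P.amount phat p (k + 1) j =
    P.amount phat p k j + P.phaseLength phat k * P.phaseRates phat p k j := rfl

theorem mem_alive {k : ℕ} {j : Fin n} : j ∈ P.alive phat p k ↔ P.amount phat p k j < p j :=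
  mem_unfinished

theorem phaseRates_eq_zero {k : ℕ} {j : Fin n} (hj : j ∉ P.alive phat p k) :
    P.phaseRates phat p k j = 0 := by
  unfold phaseRates thresholdRates
  rw [P.fair_eq_zero hj, ite_self]

theorem phaseLength_succ (k : ℕ) :
    P.phaseLength phat (k + 1) = 3 / 2 * P.phaseLength phat k := by
  unfold phaseLength
  rw [pow_succ]; ring

theorem phaseLength_pos (hphat : ∀ j, 0 < phat j) (k : ℕ) : 0 < P.phaseLength phat k := by
  have h1 : 0 ≤ ∑ j, (phat j)⁻¹ := Finset.sum_nonneg fun j _ => (inv_pos.2 (hphat j)).le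
  have := P.rateBound_pos
  unfold phaseLength
  positivity

theorem two_mul_phaseLength_zero_le (hphat : ∀ j, 0 < phat j) (j : Fin n) :
    2 * P.phaseLength phat 0 ≤ phat j / P.rateBound := by
  have hb := P.rateBound_pos
  have h0 : ∀ i ∈ Finset.univ, 0 ≤ (phat i)⁻¹ := fun i _ => (inv_pos.2 (hphat i)).le
  have h1 : 0 ≤ ∑ j, (phat j)⁻¹ := Finset.sum_nonneg h0
  have h2 : (phat j)⁻¹ ≤ ∑ j, (phat j)⁻¹ := Finset.single_le_sum h0 (Finset.mem_univ j)
  have h3 : 1 ≤ phat j * (1 + ∑ j, (phat j)⁻¹) := by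
    have := mul_le_mul_of_nonneg_left h2 (hphat j).le
    rw [mul_inv_cancel₀ (hphat j).ne'] at this
    nlinarith [hphat j]
  have h4 : 2 * P.phaseLength phat 0 = (1 / (1 + ∑ j, (phat j)⁻¹)) / P.rateBound := by
    unfold phaseLength
    field_simp
  rw [h4]
  refine div_le_div_of_nonneg_right ?_ hb.le
  rwa [div_le_iff₀ (by linarith)]

theorem amount_mono (hphat : ∀ j, 0 < phat j) (j : Fin n) :
    Monotone fun k => P.amount phat p k j := by
  refine monotone_nat_of_le_succ fun k => ?_
  rw [amount_succ]
  have := mul_nonneg (P.phaseLength_pos hphat k).le ((P.phaseRates_mem (phat := phat) (p := p) k).1 j)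
  linarith

theorem alive_succ_subset (hphat : ∀ j, 0 < phat j) (k : ℕ) :
    P.alive phat p (k + 1) ⊆ P.alive phat p k := by
  intro j hj
  rw [mem_alive] at hj ⊢
  exact (P.amount_mono hphat j k.le_succ).trans_lt hj

/-- Whether or not the job takes part in the phase, if it survives the phase then the fair rate
would have given it little more than its requirement. -/
theorem phaseLength_mul_fair_le (hphat : ∀ j, 0 < phat j) (hp : ∀ j, phat j ≤ p j) {k : ℕ}
    {j : Fin n} (hj : j ∈ P.alive phat p (k + 1)) :
    P.phaseLength phat k * P.fair (P.alive phat p k) j ≤ 31 / 30 * p j := by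
  have h0 : 0 ≤ P.amount phat p k j := P.amount_mono hphat j k.zero_le
  have hpj := (hphat j).trans_le (hp j)
  rw [mem_alive, amount_succ] at hj
  unfold phaseRates thresholdRates at hj
  split_ifs at hj with h
  · linarith
  · have h1 : max (P.amount phat p k j) (phat j) ≤ p j := max_le (by linarith) (hp j)
    linarith

theorem exists_alive_eq_empty (hphat : ∀ j, 0 < phat j) (hp : ∀ j, phat j ≤ p j) :
    ∃ K, P.alive phat p K = ∅ := by
  have hev : ∀ᶠ k in Filter.atTop, ∀ U : Finset (Fin n), ∀ j : Fin n, j ∈ U →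
      2 * p j < P.phaseLength phat k * P.fair U j := by
    rw [Filter.eventually_all]; intro U
    rw [Filter.eventually_all]; intro j
    by_cases hj : j ∈ U
    · simp only [hj, true_imp_iff]
      have h0 : 0 < P.phaseLength phat 0 * P.fair U j :=
        mul_pos (P.phaseLength_pos hphat 0) (P.fair_pos hj)
      have := (tendsto_pow_atTop_atTop_of_one_lt (by norm_num : (1 : ℝ) < 3 / 2)).atTop_mul_const h0
      filter_upwards [this.eventually_gt_atTop (2 * p j)] with k hk
      unfold phaseLength at hk ⊢
      linarith
    · simp [hj]
  obtain ⟨k, hk⟩ := hev.exists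
  refine ⟨k + 1, Finset.eq_empty_of_forall_notMem fun j hj => ?_⟩
  have h1 := hk _ j (P.alive_succ_subset hphat k hj)
  have h2 := P.phaseLength_mul_fair_le hphat hp hj
  have := (hphat j).trans_le (hp j)
  linarith

/-- While some job is unfinished, some later phase processes a job. -/
theorem exists_thresholdRates_ne_zero (hphat : ∀ j, 0 < phat j) (e : Fin n → ℝ)
    {U : Finset (Fin n)} (hU : U.Nonempty) (k : ℕ) :
    ∃ k', k ≤ k' ∧ P.thresholdRates phat (P.phaseLength phat k') e U ≠ 0 := by
  obtain ⟨j, hj⟩ := hU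
  have h0 : 0 < P.phaseLength phat 0 * P.fair U j :=
    mul_pos (P.phaseLength_pos hphat 0) (P.fair_pos hj)
  have := (tendsto_pow_atTop_atTop_of_one_lt (by norm_num : (1 : ℝ) < 3 / 2)).atTop_mul_const h0
  obtain ⟨k', hk', hkk⟩ := ((this.eventually_ge_atTop (1 / 30 * max (e j) (phat j))).and
    (Filter.eventually_ge_atTop k)).exists
  refine ⟨k', hkk, fun h => (P.fair_pos hj).ne' ?_⟩
  have h1 := congrFun h j
  unfold thresholdRates at h1
  rwa [if_pos] at h1
  unfold phaseLength at hk' ⊢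
  linarith

/-! ### The competitive ratio -/

/-- The contribution of the times between `2 / 3 * τ` and `τ` to the total completion time, bounded
from below by the numbers of unfinished jobs at the times `5 / 6 * τ` and `τ`. -/
theorem le_sum_min_sub_min {C : Fin n → ℝ} {V : Finset (Fin n)} {τ γ : ℝ} (hτ : 0 < τ)
    (hγ : ∀ t, 0 < t → ((V.filter fun j => C j < t).card : ℝ) ≤ γ * t) :
    τ / 6 * (2 * V.card - γ * (11 / 6 * τ)) ≤ ∑ j, (min (C j) τ - min (C j) (2 / 3 * τ)) := by
  have hterm : ∀ j, τ / 6 * ((if C j < τ then 0 else 1) + (if C j < 5 / 6 * τ then 0 else 1)) ≤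
      min (C j) τ - min (C j) (2 / 3 * τ) := by
    intro j
    rcases lt_or_ge (C j) (2 / 3 * τ) with h1 | h1
    · rw [if_pos (by linarith), if_pos (by linarith), min_eq_left (by linarith),
        min_eq_left (by linarith)]
      simp
    · rw [min_eq_right h1]
      rcases lt_or_ge (C j) τ with h2 | h2
      · rw [min_eq_left h2.le, if_pos h2]
        split_ifs <;> linarith
      · rw [min_eq_right h2, if_neg (by linarith), if_neg (by linarith)]
        linarith
  have hcount : ∀ t, ∑ j ∈ V, (if C j < t then (0 : ℝ) else 1) =
      V.card - (V.filter fun j => C j < t).card := by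
    intro t
    rw [Finset.card_eq_sum_ones, Finset.card_filter, Nat.cast_sum, Nat.cast_sum,
      ← Finset.sum_sub_distrib]
    refine Finset.sum_congr rfl fun j _ => ?_
    split_ifs <;> simp
  have h1 : ∑ j ∈ V, τ / 6 * ((if C j < τ then (0 : ℝ) else 1) +
      (if C j < 5 / 6 * τ then 0 else 1)) ≤ ∑ j, (min (C j) τ - min (C j) (2 / 3 * τ)) := by
    refine (Finset.sum_le_sum fun j _ => hterm j).trans
      (Finset.sum_le_sum_of_subset_of_nonneg (Finset.subset_univ V) fun j _ _ => ?_)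
    exact sub_nonneg.2 (min_le_min_left _ (by linarith))
  rw [← Finset.mul_sum, Finset.sum_add_distrib, hcount, hcount] at h1
  refine le_trans (mul_le_mul_of_nonneg_left ?_ (by linarith)) h1
  have h2 := hγ τ hτ
  have h3 := hγ (5 / 6 * τ) (by linarith)
  linarith

/-- The total time that the jobs spend in the phases is at most 27 times the total completion time
of an arbitrary feasible schedule. -/
theorem sum_phaseLength_mul_card_le (hphat : ∀ j, 0 < phat j) (hp : ∀ j, phat j ≤ p j) {K : ℕ}
    (hK : P.alive phat p K = ∅) {y : ℝ → Fin n → ℝ} (hy : P.Feasible y) {C : Fin n → ℝ}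
    (hC0 : ∀ j, 0 ≤ C j) (hC : ∀ j, completionTime y p j = ENNReal.ofReal (C j)) :
    ∑ k ∈ Finset.range K, P.phaseLength phat k * (P.alive phat p k).card ≤ 27 * ∑ j, C j := by
  set T := P.phaseLength phat with hTdef
  set u : ℕ → ℝ := fun k => (P.alive phat p k).card with hu
  have hTpos : ∀ k, 0 < T k := P.phaseLength_pos hphat
  have hTsucc : ∀ k, T (k + 1) = 3 / 2 * T k := P.phaseLength_succ
  -- With the threshold 0 in place of `1 / 30`, the best sampling point would be `4 / 11 * T k` and
  -- give the factor 24.75 up to the contribution of the first phase. The slack to 27 pays for that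
  -- contribution, for the threshold, and for rounding `4 / 11` to `7 / 20`.
  have hphase : ∀ k, 7 / 60 * (T k * u (k + 1)) - 1 / 9 * (7 / 20) * (T k * u k) ≤
      ∑ j, (min (C j) (7 / 20 * T k) - min (C j) (2 / 3 * (7 / 20 * T k))) := by
    intro k
    have hτ : 0 < 7 / 20 * T k := by linarith [hTpos k]
    have := le_sum_min_sub_min (C := C) (V := P.alive phat p (k + 1)) hτ
      (γ := 31 / 30 * u k / T k) ?_
    · refine le_trans ?_ this
      have e : 31 / 30 * u k / T k * (11 / 6 * (7 / 20 * T k)) =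
          31 / 30 * (11 / 6) * (7 / 20) * u k := by
        field_simp [(hTpos k).ne']
      rw [e]
      have h1 : 0 ≤ T k * u k := mul_nonneg (hTpos k).le (Nat.cast_nonneg _)
      have h2 : 7 / 20 * T k / 6 * (2 * (P.alive phat p (k + 1)).card -
          31 / 30 * (11 / 6) * (7 / 20) * u k) = 7 / 60 * (T k * u (k + 1)) -
          7 / 120 * (31 / 30 * (11 / 6) * (7 / 20)) * (T k * u k) := by
        simp only [hu]; ring
      rw [h2]
      linarith
    · intro t ht
      rw [div_mul_eq_mul_div, le_div_iff₀ (hTpos k)]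
      refine hy.card_mul_le (p := p) (X := (P.alive phat p (k + 1)).filter fun j => C j < t)
        ((Finset.filter_subset _ _).trans (P.alive_succ_subset hphat k)) ht (by norm_num) ?_ ?_
      · intro j hj
        exact P.phaseLength_mul_fair_le hphat hp (Finset.mem_filter.1 hj).1
      · intro j hj
        rw [hC j]
        exact (ENNReal.ofReal_lt_ofReal_iff ht).2 (Finset.mem_filter.1 hj).2
  have htel : ∀ m j, ∑ k ∈ Finset.range m,
      (min (C j) (7 / 20 * T k) - min (C j) (2 / 3 * (7 / 20 * T k))) ≤
        min (C j) (2 / 3 * (7 / 20 * T m)) := by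
    intro m j
    induction m with
    | zero => simpa using ⟨hC0 j, (hTpos 0).le⟩
    | succ m ih =>
      rw [Finset.sum_range_succ, hTsucc]
      have : 2 / 3 * (7 / 20 * (3 / 2 * T m)) = 7 / 20 * T m := by ring
      rw [this]
      linarith
  have hupper : ∑ k ∈ Finset.range K,
      (7 / 60 * (T k * u (k + 1)) - 1 / 9 * (7 / 20) * (T k * u k)) ≤ ∑ j, C j := by
    refine (Finset.sum_le_sum fun k _ => hphase k).trans ?_
    rw [Finset.sum_comm]
    exact Finset.sum_le_sum fun j _ => (htel K j).trans (min_le_left _ _)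
  have hshift : ∀ m, ∑ k ∈ Finset.range m, T k * u (k + 1) =
      2 / 3 * (∑ k ∈ Finset.range m, T k * u k - T 0 * u 0 + T m * u m) := by
    intro m
    induction m with
    | zero => simp
    | succ m ih =>
      rw [Finset.sum_range_succ, Finset.sum_range_succ, ih, hTsucc]
      ring
  have hfirst : 2 * (T 0 * u 0) ≤ ∑ j, C j := by
    have h1 : ∑ _j : Fin n, 2 * T 0 ≤ ∑ j, C j := by
      refine Finset.sum_le_sum fun j _ => ?_
      refine (P.two_mul_phaseLength_zero_le hphat j).trans ?_
      have h2 := hy.le_completionTime p j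
      rw [hC j, ENNReal.ofReal_le_ofReal_iff (hC0 j)] at h2
      exact le_trans (div_le_div_of_nonneg_right (hp j) P.rateBound_pos.le) h2
    rw [Finset.sum_const, Finset.card_univ, Fintype.card_fin, nsmul_eq_mul] at h1
    have h3 : u 0 ≤ n := by
      simp only [hu]
      exact_mod_cast (Finset.card_le_univ _).trans_eq (Fintype.card_fin n)
    nlinarith [hTpos 0]
  have huK : u K = 0 := by simp [hu, hK]
  rw [Finset.sum_sub_distrib, ← Finset.mul_sum, ← Finset.mul_sum, hshift K, huK] at hupper
  have hC1 : 0 ≤ ∑ j, C j := Finset.sum_nonneg fun j _ => hC0 j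
  linarith

theorem ofReal_sum_phaseLength_mul_card_le_opt (hphat : ∀ j, 0 < phat j) (hp : ∀ j, phat j ≤ p j)
    {K : ℕ} (hK : P.alive phat p K = ∅) :
    ENNReal.ofReal
      ((∑ k ∈ Finset.range K, P.phaseLength phat k * (P.alive phat p k).card) / 27) ≤ P.opt p := by
  refine le_iInf₂ fun y hy => ?_
  by_cases htop : ∃ j, completionTime y p j = ∞
  · have : totalCompletionTime y p = ∞ := ENNReal.sum_eq_top.2 (by simpa using htop)
    rw [this]
    exact le_top
  · push Not at htop
    have h := P.sum_phaseLength_mul_card_le hphat hp hK hy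
      (C := fun j => (completionTime y p j).toReal) (fun j => ENNReal.toReal_nonneg)
      (fun j => (ENNReal.ofReal_toReal (htop j)).symm)
    rw [totalCompletionTime, ENNReal.ofReal_le_iff_le_toReal (ENNReal.sum_ne_top.2 fun j _ => htop j),
      ENNReal.toReal_sum fun j _ => htop j]
    linarith

/-! ### The number of phases in which a job takes part -/

/-- Each phase that processes a job raises the logarithm of one plus the ratio of its amount and its
prediction by a constant. -/
theorem participations_mul_le (hphat : ∀ j, 0 < phat j) (hp : ∀ j, phat j ≤ p j) (j : Fin n)
    (k : ℕ) :
    ((((Finset.range k).filter fun i => P.phaseRates phat p i j ≠ 0).card : ℝ) *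
        Real.logb 2 (61 / 60) ≤ Real.logb 2 (61 / 60) + (1 + Real.logb 2 (p j / phat j))) ∧
      (j ∈ P.alive phat p k →
        (((Finset.range k).filter fun i => P.phaseRates phat p i j ≠ 0).card : ℝ) *
          Real.logb 2 (61 / 60) ≤ Real.logb 2 (1 + P.amount phat p k j / phat j)) := by
  have hl : 0 < Real.logb 2 (61 / 60) := Real.logb_pos (by norm_num) (by norm_num)
  have hpj := hphat j
  have hrat : 1 ≤ p j / phat j := (one_le_div hpj).2 (hp j)
  have hr0 : 0 ≤ Real.logb 2 (p j / phat j) := Real.logb_nonneg (by norm_num) hrat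
  induction k with
  | zero =>
    have : P.amount phat p 0 j = 0 := rfl
    refine ⟨by simp; positivity, fun _ => by simp [this]⟩
  | succ k ih =>
    have h0 : 0 ≤ P.amount phat p k j := P.amount_mono hphat j k.zero_le
    rw [Finset.range_add_one, Finset.filter_insert]
    by_cases hz : P.phaseRates phat p k j = 0
    · rw [if_neg (by simpa using hz)]
      refine ⟨ih.1, fun hj => ?_⟩
      rw [amount_succ, hz, mul_zero, add_zero]
      exact ih.2 (P.alive_succ_subset hphat k hj)
    · have hj : j ∈ P.alive phat p k := by
        by_contra hj
        exact hz (P.phaseRates_eq_zero hj)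
      rw [if_pos hz, Finset.card_insert_of_notMem (by simp)]
      push_cast
      have h2 := ih.2 hj
      set m : ℝ := (((Finset.range k).filter fun i => P.phaseRates phat p i j ≠ 0).card : ℝ)
      have hx : 0 ≤ P.amount phat p k j / phat j := div_nonneg h0 hpj.le
      constructor
      · have h3 : Real.logb 2 (1 + P.amount phat p k j / phat j) ≤
            1 + Real.logb 2 (p j / phat j) := by
          have h4 : 1 + Real.logb 2 (p j / phat j) = Real.logb 2 (2 * (p j / phat j)) := by
            rw [Real.logb_mul (by norm_num) (by linarith), Real.logb_self_eq_one (by norm_num)]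
          rw [h4]
          refine Real.logb_le_logb_of_le (by norm_num) (by linarith) ?_
          have := div_le_div_of_nonneg_right (P.mem_alive.1 hj).le hpj.le
          linarith
        linarith
      · intro _
        have h3 : 1 / 30 * max (P.amount phat p k j) (phat j) ≤
            P.phaseLength phat k * P.phaseRates phat p k j := by
          unfold phaseRates thresholdRates at hz ⊢
          split_ifs at hz ⊢ with h
          · exact h
          · exact absurd rfl hz
        have h4 : 61 / 60 * (1 + P.amount phat p k j / phat j) ≤
            1 + P.amount phat p (k + 1) j / phat j := by
          rw [amount_succ]
          have h5 := le_max_left (P.amount phat p k j) (phat j)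
          have h6 := le_max_right (P.amount phat p k j) (phat j)
          have e1 : 61 / 60 * (1 + P.amount phat p k j / phat j) =
              61 / 60 * (phat j + P.amount phat p k j) / phat j := by field_simp
          have e2 : 1 + (P.amount phat p k j + P.phaseLength phat k * P.phaseRates phat p k j) /
              phat j = (phat j + (P.amount phat p k j +
                P.phaseLength phat k * P.phaseRates phat p k j)) / phat j := by field_simp
          rw [e1, e2]
          refine div_le_div_of_nonneg_right ?_ hpj.le
          linarith
        have h7 := Real.logb_le_logb_of_le (b := 2) (by norm_num) (by positivity) h4
        rw [Real.logb_mul (by norm_num) (by positivity)] at h7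
        linarith

end RatePolytope

/-! ### Executed schedules -/

namespace Problem

universe u

variable (S : Problem.{u} n)

theorem processed_append (σ σ' : List (Segment S.Config)) (j : Fin n) :
    S.processed (σ ++ σ') j = S.processed σ j + S.processed σ' j := by
  simp [processed]

theorem processed_cons (s : Segment S.Config) (σ : List (Segment S.Config)) (j : Fin n) :
    S.processed (s :: σ) j = s.len * S.rate s.config j + S.processed σ j := by
  simp [processed]

theorem makespan_append (σ σ' : List (Segment S.Config)) :
    S.makespan (σ ++ σ') = S.makespan σ + S.makespan σ' := by
  simp [makespan]

theorem makespan_cons (s : Segment S.Config) (σ : List (Segment S.Config)) :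
    S.makespan (s :: σ) = s.len + S.makespan σ := by
  simp [makespan]

variable {S}

theorem makespan_nonneg {σ : List (Segment S.Config)} (hσ : ∀ s ∈ σ, 0 < s.len) :
    0 ≤ S.makespan σ :=
  List.sum_nonneg fun x hx => by
    obtain ⟨s, hs, rfl⟩ := List.mem_map.1 hx
    exact (hσ s hs).le

theorem processed_nonneg {σ : List (Segment S.Config)} (hσ : ∀ s ∈ σ, 0 < s.len) (j : Fin n) :
    0 ≤ S.processed σ j :=
  List.sum_nonneg fun x hx => by
    obtain ⟨s, hs, rfl⟩ := List.mem_map.1 hx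
    exact mul_nonneg (hσ s hs).le ((S.rate_mem _).1 j)

theorem integral_rateAt_append {σ σ' : List (Segment S.Config)} (hσ : ∀ s ∈ σ, 0 < s.len)
    (j : Fin n) :
    ∫ t in (0 : ℝ)..S.makespan σ, S.rateAt (σ ++ σ') t j = S.processed σ j := by
  induction σ with
  | nil => simp [makespan, processed]
  | cons s σ ih =>
    have hs : 0 < s.len := hσ s (by simp)
    have hσ' : ∀ s ∈ σ, 0 < s.len := fun x hx => hσ x (by simp [hx])
    have hm := makespan_nonneg hσ'
    have hf := S.feasible_rateAt (s :: σ ++ σ')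
    rw [makespan_cons, processed_cons, ← intervalIntegral.integral_add_adjacent_intervals
      (hf.intervalIntegrable j le_rfl hs.le)
      (hf.intervalIntegrable j hs.le (le_add_of_nonneg_right hm))]
    congr 1
    · rw [intervalIntegral.integral_of_le hs.le, MeasureTheory.integral_Ioc_eq_integral_Ioo,
        MeasureTheory.setIntegral_congr_fun measurableSet_Ioo
          (g := fun _ => S.rate s.config j) fun t ht => by simp [rateAt, ht.2]]
      simp [hs.le]
    · have h1 : ∀ t ∈ Set.uIcc s.len (s.len + S.makespan σ),
          S.rateAt (s :: σ ++ σ') t j = S.rateAt (σ ++ σ') (t - s.len) j := by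
        intro t ht
        rw [Set.uIcc_of_le (by linarith)] at ht
        simp [rateAt, not_lt.2 ht.1]
      rw [intervalIntegral.integral_congr h1,
        intervalIntegral.integral_comp_sub_right (fun t => S.rateAt (σ ++ σ') t j), sub_self,
        add_sub_cancel_left, ih hσ']

theorem completionTime_rateAt_append_le {σ σ' : List (Segment S.Config)}
    (hσ : ∀ s ∈ σ, 0 < s.len) {p : Fin n → ℝ} {j : Fin n} (hp : p j ≤ S.processed σ j) :
    completionTime (S.rateAt (σ ++ σ')) p j ≤ ENNReal.ofReal (S.makespan σ) := by
  refine iInf₂_le_of_le (S.makespan σ).toNNReal ?_ le_rfl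
  rw [Real.coe_toNNReal _ (makespan_nonneg hσ), integral_rateAt_append hσ]
  exact hp

/-- Segments that do not process a job do not preempt it. -/
theorem preemptions_append_of_processed_eq_zero {σ : List (Segment S.Config)}
    (hσ : ∀ s ∈ σ, 0 < s.len) {j : Fin n} (h0 : S.processed σ j = 0) (r : ℝ)
    (σ' : List (Segment S.Config)) :
    S.preemptions j r (σ ++ σ') = S.preemptions j r σ' := by
  induction σ with
  | nil => rfl
  | cons s σ ih =>
    have hs : 0 < s.len := hσ s (by simp)
    have hσ' : ∀ s ∈ σ, 0 < s.len := fun x hx => hσ x (by simp [hx])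
    have h1 := mul_nonneg hs.le ((S.rate_mem s.config).1 j)
    have h2 := processed_nonneg hσ' j
    rw [processed_cons] at h0
    have h3 : s.len * S.rate s.config j = 0 := by linarith
    have h4 : S.rate s.config j = 0 := (mul_eq_zero.1 h3).resolve_left hs.ne'
    rw [← ih hσ' (by linarith)]
    rcases hτ : σ ++ σ' with _ | ⟨s', τ⟩
    · simp [hτ, preemptions]
    · simp [hτ, preemptions, h4]

/-- Prepending a schedule `σ` to `σ'` adds, besides the preemptions that occur in `σ` before a job
has got its whole share of `σ`, at most one preemption: it occurs in the last segment of `σ` that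
processes the job. -/
theorem preemptions_append_le {σ : List (Segment S.Config)} (hσ : ∀ s ∈ σ, 0 < s.len)
    (j : Fin n) (r : ℝ) (σ' : List (Segment S.Config)) :
    S.preemptions j r (σ ++ σ') ≤ S.preemptions j (S.processed σ j) σ + 1 +
      S.preemptions j (r - S.processed σ j) σ' := by
  induction σ generalizing r with
  | nil => simp [processed]
  | cons s σ ih =>
    have hσ' : ∀ s ∈ σ, 0 < s.len := fun x hx => hσ x (by simp [hx])
    have hcons : ∀ r (τ : List (Segment S.Config)), S.preemptions j r (s :: τ) ≤
        1 + S.preemptions j (r - s.len * S.rate s.config j) τ := by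
      intro r τ
      rcases τ with _ | ⟨s', τ⟩
      · simp [preemptions]
      · rw [preemptions]
        split_ifs <;> omega
    rw [processed_cons, List.cons_append]
    by_cases h0 : S.processed σ j = 0
    · have := hcons r (σ ++ σ')
      rw [preemptions_append_of_processed_eq_zero hσ' h0] at this
      rw [h0, add_zero]
      omega
    · rcases σ with _ | ⟨s', σ⟩
      · exact absurd (by simp [processed]) h0
      · have hpos : 0 < S.processed (s' :: σ) j := lt_of_le_of_ne' (processed_nonneg hσ' j) h0
        have := ih hσ' (r - s.len * S.rate s.config j)
        rw [sub_sub] at this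
        rw [List.cons_append, preemptions, preemptions, add_sub_cancel_left]
        rw [List.cons_append] at this
        have hlt : s.len * S.rate s.config j <
            s.len * S.rate s.config j + S.processed (s' :: σ) j := by linarith
        split_ifs <;> first | omega | (exfalso; tauto)

/-! ### The algorithm -/

variable (S)

/-- The memory of the algorithm: the number of the next phase that has not been planned, the
amounts that the jobs will have received after the planned phases, the jobs unfinished at present,
and the planned segments that are still to be executed. -/
structure State where
  phase : ℕ
  amount : Fin n → ℝ
  jobs : Finset (Fin n)
  queue : List (Segment S.Config)

variable (proc : (Fin n → ℝ) → ℝ → List (Segment S.Config)) (phat : Fin n → ℝ)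

open Classical in
/-- When nothing is left to execute, the algorithm plans the next phase that processes some job.
Phases that process no job are skipped. -/
def refill (st : S.State) : S.State :=
  if h : st.queue = [] ∧ ∃ k, st.phase ≤ k ∧
      S.thresholdRates phat (S.phaseLength phat k) st.amount st.jobs ≠ 0 then
    let k := Nat.find h.2
    let y := S.thresholdRates phat (S.phaseLength phat k) st.amount st.jobs
    ⟨k + 1, fun j => st.amount j + S.phaseLength phat k * y j, st.jobs,
      proc y (S.phaseLength phat k)⟩
  else st

/-- The update of the memory after a segment has been executed. -/
def observe (st : S.State) (x : Segment S.Config × Finset (Fin n)) : S.State :=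
  ⟨(S.refill proc phat st).phase, (S.refill proc phat st).amount, x.2ᶜ,
    (S.refill proc phat st).queue.tail⟩

/-- A decision of no significance, for situations that do not occur. -/
def defaultDecision : Decision S.Config := ⟨S.nonempty.some, 1, one_pos, false⟩

open Classical in
/-- The decision to execute the first planned segment. -/
def headDecision : List (Segment S.Config) → Decision S.Config
  | [] => S.defaultDecision
  | s :: _ => if h : 0 < s.len then ⟨s.config, s.len, h, false⟩ else S.defaultDecision

/-- The memory of the algorithm after a given history. -/
def stateAfter (h : S.History) : S.State :=
  h.foldl (S.observe proc phat) ⟨0, 0, Finset.univ, []⟩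

/-- The algorithm: in phases of geometrically growing length, it lets the procedure execute the
fair rates of the jobs unfinished at the beginning of the phase, leaving out the jobs for which the
phase would not make enough progress. -/
def phaseAlgorithm : S.Algorithm := fun phat h =>
  S.headDecision (S.refill proc phat (S.stateAfter proc phat h)).queue

variable {S proc phat} {p : Fin n → ℝ}

theorem run_succ_of_queue {N : ℕ} {s : Segment S.Config} {q : List (Segment S.Config)}
    (hs : 0 < s.len)
    (hq : (S.refill proc phat
      (S.stateAfter proc phat (S.run (S.phaseAlgorithm proc) phat p N))).queue = s :: q) :
    S.run (S.phaseAlgorithm proc) phat p (N + 1) = S.run (S.phaseAlgorithm proc) phat p N ++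
      [(s, S.finished p (S.schedule (S.phaseAlgorithm proc) phat p N ++ [s]))] := by
  have h1 : S.phaseAlgorithm proc phat (S.run (S.phaseAlgorithm proc) phat p N) =
      ⟨s.config, s.len, hs, false⟩ := by
    rw [phaseAlgorithm, hq, headDecision, dif_pos hs]
  rw [run, h1]
  simp [elapsed, schedule]

/-- The algorithm executes the planned segments one after the other. -/
theorem exists_run_of_queue {q : List (Segment S.Config)} (hq : q ≠ []) (hpos : ∀ s ∈ q, 0 < s.len)
    {N k : ℕ} {e : Fin n → ℝ} {U : Finset (Fin n)}
    (h : S.refill proc phat (S.stateAfter proc phat (S.run (S.phaseAlgorithm proc) phat p N)) =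
      ⟨k, e, U, q⟩) :
    ∃ N', S.schedule (S.phaseAlgorithm proc) phat p N' =
        S.schedule (S.phaseAlgorithm proc) phat p N ++ q ∧
      S.stateAfter proc phat (S.run (S.phaseAlgorithm proc) phat p N') =
        ⟨k, e, (S.finished p (S.schedule (S.phaseAlgorithm proc) phat p N ++ q))ᶜ, []⟩ := by
  induction q generalizing N U with
  | nil => exact absurd rfl hq
  | cons s q ih =>
    have hrun := run_succ_of_queue (p := p) (N := N) (hpos s (by simp)) (by rw [h])
    have hsched : S.schedule (S.phaseAlgorithm proc) phat p (N + 1) =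
        S.schedule (S.phaseAlgorithm proc) phat p N ++ [s] := by
      rw [schedule, hrun]
      simp [executed, schedule]
    have hstate : S.stateAfter proc phat (S.run (S.phaseAlgorithm proc) phat p (N + 1)) =
        ⟨k, e, (S.finished p (S.schedule (S.phaseAlgorithm proc) phat p N ++ [s]))ᶜ, q⟩ := by
      rw [hrun, stateAfter, List.foldl_append, ← stateAfter, List.foldl_cons, List.foldl_nil,
        observe, h]
      rfl
    by_cases hq' : q = []
    · subst hq'
      exact ⟨N + 1, hsched, hstate⟩
    · obtain ⟨N', h1, h2⟩ := ih hq' (fun x hx => hpos x (by simp [hx])) (N := N + 1)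
        (by rw [hstate, refill, dif_neg (by simp [hq'])])
      rw [hsched, List.append_assoc, List.singleton_append] at h1 h2
      exact ⟨N', h1, h2⟩

theorem refill_eq {k k' : ℕ} {e : Fin n → ℝ} {U : Finset (Fin n)} (hk : k ≤ k')
    (h0 : ∀ i, k ≤ i → i < k' → S.thresholdRates phat (S.phaseLength phat i) e U = 0)
    (hne : S.thresholdRates phat (S.phaseLength phat k') e U ≠ 0) :
    S.refill proc phat ⟨k, e, U, []⟩ = ⟨k' + 1,
      fun j => e j + S.phaseLength phat k' *
        S.thresholdRates phat (S.phaseLength phat k') e U j, U,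
      proc (S.thresholdRates phat (S.phaseLength phat k') e U) (S.phaseLength phat k')⟩ := by
  classical
  have hex : ∃ i, k ≤ i ∧ S.thresholdRates phat (S.phaseLength phat i) e U ≠ 0 := ⟨k', hk, hne⟩
  have hfind : Nat.find hex = k' := by
    rw [Nat.find_eq_iff]
    exact ⟨⟨hk, hne⟩, fun i hi hh => hh.2 (h0 i hh.1 hi)⟩
  rw [refill, dif_pos ⟨rfl, hex⟩]
  simp only
  have : ∀ inst : DecidablePred fun i => k ≤ i ∧
      S.thresholdRates phat (S.phaseLength phat i) e U ≠ 0, @Nat.find _ inst hex = k' := by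
    intro inst
    convert hfind
  rw [this]

variable (S proc phat p)

open Classical in
/-- The segments executed in phase `k`. -/
def phaseSegments (k : ℕ) : List (Segment S.Config) :=
  if S.phaseRates phat p k = 0 then [] else proc (S.phaseRates phat p k) (S.phaseLength phat k)

/-- The schedule executed before phase `k`. -/
def phaseSchedule : ℕ → List (Segment S.Config)
  | 0 => []
  | k + 1 => phaseSchedule k ++ S.phaseSegments proc phat p k

variable {S proc phat p} {α : ℝ} {c : ℕ}

theorem phaseSegments_len_pos (hproc : S.IsProcedure α c proc) (hphat : ∀ j, 0 < phat j) (k : ℕ) :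
    ∀ s ∈ S.phaseSegments proc phat p k, 0 < s.len := by
  unfold phaseSegments
  split_ifs
  · simp
  · exact (hproc _ (S.phaseRates_mem k) _ (S.phaseLength_pos hphat k)).len_pos

theorem phaseSchedule_len_pos (hproc : S.IsProcedure α c proc) (hphat : ∀ j, 0 < phat j) (k : ℕ) :
    ∀ s ∈ S.phaseSchedule proc phat p k, 0 < s.len := by
  induction k with
  | zero => simp [phaseSchedule]
  | succ k ih =>
    intro s hs
    rcases List.mem_append.1 hs with h | h
    · exact ih s h
    · exact phaseSegments_len_pos hproc hphat k s h

theorem processed_phaseSegments (hproc : S.IsProcedure α c proc) (hphat : ∀ j, 0 < phat j) (k : ℕ)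
    (j : Fin n) : S.processed (S.phaseSegments proc phat p k) j =
      S.phaseLength phat k * S.phaseRates phat p k j := by
  unfold phaseSegments
  split_ifs with h
  · simp [h, processed]
  · exact (hproc _ (S.phaseRates_mem k) _ (S.phaseLength_pos hphat k)).processed_eq j

theorem processed_phaseSchedule (hproc : S.IsProcedure α c proc) (hphat : ∀ j, 0 < phat j) (k : ℕ)
    (j : Fin n) : S.processed (S.phaseSchedule proc phat p k) j = S.amount phat p k j := by
  induction k with
  | zero => simp [phaseSchedule, processed, RatePolytope.amount]
  | succ k ih =>
    rw [phaseSchedule, processed_append, ih, processed_phaseSegments hproc hphat,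
      RatePolytope.amount_succ]

theorem compl_finished_phaseSchedule (hproc : S.IsProcedure α c proc) (hphat : ∀ j, 0 < phat j)
    (k : ℕ) : (S.finished p (S.phaseSchedule proc phat p k))ᶜ = S.alive phat p k := by
  ext j
  simp [finished, processed_phaseSchedule hproc hphat, RatePolytope.mem_alive]

/-- The algorithm executes the phases one after the other. -/
theorem exists_schedule_eq_phaseSchedule (hproc : S.IsProcedure α c proc)
    (hphat : ∀ j, 0 < phat j) (hp : ∀ j, phat j ≤ p j) (k : ℕ) :
    ∃ N, S.schedule (S.phaseAlgorithm proc) phat p N = S.phaseSchedule proc phat p k ∧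
      ((S.alive phat p k).Nonempty →
        S.refill proc phat (S.stateAfter proc phat (S.run (S.phaseAlgorithm proc) phat p N)) =
          S.refill proc phat ⟨k, S.amount phat p k, S.alive phat p k, []⟩) := by
  induction k with
  | zero =>
    refine ⟨0, rfl, fun _ => ?_⟩
    have : S.alive phat p 0 = Finset.univ := by
      ext j
      simpa [RatePolytope.mem_alive, RatePolytope.amount] using (hphat j).trans_le (hp j)
    rw [this]
    rfl
  | succ k ih =>
    obtain ⟨N, hN, hst⟩ := ih
    by_cases h0 : S.phaseRates phat p k = 0
    · have hamount : S.amount phat p (k + 1) = S.amount phat p k := by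
        ext j
        simp [RatePolytope.amount_succ, h0]
      have halive : S.alive phat p (k + 1) = S.alive phat p k := by
        rw [RatePolytope.alive, hamount, ← RatePolytope.alive]
      refine ⟨N, by rw [hN, phaseSchedule, phaseSegments, if_pos h0, List.append_nil], fun hne => ?_⟩
      rw [halive] at hne
      rw [hst hne, hamount, halive]
      classical
      have hex := S.exists_thresholdRates_ne_zero hphat (S.amount phat p k) hne (k + 1)
      obtain ⟨h1, h2⟩ := Nat.find_spec hex
      have h3 : ∀ i, k + 1 ≤ i → i < Nat.find hex → S.thresholdRates phat (S.phaseLength phat i)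
          (S.amount phat p k) (S.alive phat p k) = 0 := fun i hi hlt => by
        by_contra hh
        exact Nat.find_min hex hlt ⟨hi, hh⟩
      rw [refill_eq h1 h3 h2, refill_eq (k.le_succ.trans h1) (fun i hi hlt => ?_) h2]
      rcases hi.eq_or_lt with rfl | hi
      · exact h0
      · exact h3 i hi hlt
    · have hne : (S.alive phat p k).Nonempty := by
        by_contra hne
        refine h0 (funext fun j => S.phaseRates_eq_zero ?_)
        rw [Finset.not_nonempty_iff_eq_empty.1 hne]
        simp
      have hseg : S.phaseSegments proc phat p k ≠ [] := by
        intro hnil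
        refine h0 (funext fun j => ?_)
        have h1 := processed_phaseSegments (p := p) hproc hphat k j
        rw [hnil] at h1
        simpa [processed, (S.phaseLength_pos hphat k).ne'] using h1
      have hst' := hst hne
      rw [refill_eq le_rfl (fun i hi hlt => absurd hi (not_le.2 hlt)) h0] at hst'
      have hq : S.phaseSegments proc phat p k = proc (S.phaseRates phat p k)
          (S.phaseLength phat k) := if_neg h0
      change _ = (⟨k + 1, S.amount phat p (k + 1), S.alive phat p k,
        proc (S.phaseRates phat p k) (S.phaseLength phat k)⟩ : S.State) at hst'
      rw [← hq] at hst'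
      obtain ⟨N', h1, h2⟩ := exists_run_of_queue hseg (phaseSegments_len_pos hproc hphat k) hst'
      rw [hN, ← phaseSchedule] at h1 h2
      rw [compl_finished_phaseSchedule hproc hphat] at h2
      exact ⟨N', h1, fun _ => by rw [h2]⟩

/-! ### The cost of the algorithm -/

theorem IsProcedure.nonneg (hproc : S.IsProcedure α c proc) : 0 ≤ α := by
  have h := hproc 0 S.zero_mem_rates 1 one_pos
  simpa using (makespan_nonneg h.len_pos).trans h.makespan_le

theorem makespan_phaseSchedule_le (hproc : S.IsProcedure α c proc) (hphat : ∀ j, 0 < phat j)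
    (k : ℕ) : S.makespan (S.phaseSchedule proc phat p k) ≤
      α * ∑ i ∈ Finset.range k, S.phaseLength phat i := by
  induction k with
  | zero => simp [phaseSchedule, makespan]
  | succ k ih =>
    have : S.makespan (S.phaseSegments proc phat p k) ≤ α * S.phaseLength phat k := by
      unfold phaseSegments
      split_ifs
      · simpa [makespan] using mul_nonneg hproc.nonneg (S.phaseLength_pos hphat k).le
      · exact (hproc _ (S.phaseRates_mem k) _ (S.phaseLength_pos hphat k)).makespan_le
    rw [phaseSchedule, makespan_append, Finset.sum_range_succ, mul_add]
    linarith

theorem exists_phaseSchedule_eq_append {k K : ℕ} (h : k ≤ K) :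
    ∃ σ, S.phaseSchedule proc phat p K = S.phaseSchedule proc phat p k ++ σ := by
  induction K, h using Nat.le_induction with
  | base => exact ⟨[], by simp⟩
  | succ K _ ih =>
    obtain ⟨σ, hσ⟩ := ih
    exact ⟨σ ++ S.phaseSegments proc phat p K, by rw [phaseSchedule, hσ, List.append_assoc]⟩

theorem totalCompletionTime_phaseSchedule_le (hproc : S.IsProcedure α c proc)
    (hphat : ∀ j, 0 < phat j) {K : ℕ} (hK : S.alive phat p K = ∅) :
    totalCompletionTime (S.rateAt (S.phaseSchedule proc phat p K)) p ≤ ENNReal.ofReal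
      (α * ∑ k ∈ Finset.range K, S.phaseLength phat k * (S.alive phat p k).card) := by
  classical
  have hterm : ∀ j k, 0 ≤ if j ∈ S.alive phat p k then S.phaseLength phat k else 0 := by
    intro j k
    split_ifs
    exacts [(S.phaseLength_pos hphat k).le, le_rfl]
  have hjob : ∀ j, completionTime (S.rateAt (S.phaseSchedule proc phat p K)) p j ≤
      ENNReal.ofReal (α * ∑ k ∈ Finset.range K,
        if j ∈ S.alive phat p k then S.phaseLength phat k else 0) := by
    intro j
    have hex : ∃ k, j ∉ S.alive phat p k := ⟨K, by simp [hK]⟩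
    have hkK : Nat.find hex ≤ K := Nat.find_min' hex (by simp [hK])
    obtain ⟨σ, hσ⟩ : ∃ σ, S.phaseSchedule proc phat p K =
        S.phaseSchedule proc phat p (Nat.find hex) ++ σ := exists_phaseSchedule_eq_append hkK
    rw [hσ]
    refine (completionTime_rateAt_append_le (phaseSchedule_len_pos hproc hphat _) ?_).trans
      (ENNReal.ofReal_le_ofReal ((makespan_phaseSchedule_le hproc hphat _).trans
        (mul_le_mul_of_nonneg_left ?_ hproc.nonneg)))
    · rw [processed_phaseSchedule hproc hphat]
      have := Nat.find_spec hex
      rwa [RatePolytope.mem_alive, not_lt] at this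
    · refine le_trans (le_of_eq (Finset.sum_congr rfl fun i hi => ?_))
        (Finset.sum_le_sum_of_subset_of_nonneg (Finset.range_mono hkK) fun i _ _ => hterm j i)
      rw [if_pos (not_not.1 (Nat.find_min hex (Finset.mem_range.1 hi)))]
  refine (Finset.sum_le_sum fun j _ => hjob j).trans (le_of_eq ?_)
  rw [← ENNReal.ofReal_sum_of_nonneg fun j _ =>
    mul_nonneg hproc.nonneg (Finset.sum_nonneg fun k _ => hterm j k), ← Finset.mul_sum,
    Finset.sum_comm]
  congr 2
  refine Finset.sum_congr rfl fun k _ => ?_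
  rw [← Finset.sum_filter, Finset.sum_const, nsmul_eq_mul, mul_comm]
  simp

theorem preemptions_phaseSchedule_append_le (hproc : S.IsProcedure α c proc)
    (hphat : ∀ j, 0 < phat j) (j : Fin n) (k : ℕ) (σ : List (Segment S.Config)) :
    S.preemptions j (p j) (S.phaseSchedule proc phat p k ++ σ) ≤
      (c + 1) * ((Finset.range k).filter fun i => S.phaseRates phat p i j ≠ 0).card +
        S.preemptions j (p j - S.amount phat p k j) σ := by
  induction k generalizing σ with
  | zero => simp [phaseSchedule, RatePolytope.amount]
  | succ k ih =>
    have hlen := phaseSegments_len_pos (p := p) hproc hphat k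
    have hpr := processed_phaseSegments (p := p) hproc hphat k j
    rw [phaseSchedule, List.append_assoc]
    refine (ih _).trans ?_
    rw [Finset.range_add_one, Finset.filter_insert, RatePolytope.amount_succ]
    by_cases hz : S.phaseRates phat p k j = 0
    · rw [hz, mul_zero] at hpr
      rw [if_neg (by simpa using hz), preemptions_append_of_processed_eq_zero hlen hpr, hz,
        mul_zero, add_zero]
    · have h0 : S.phaseRates phat p k ≠ 0 := fun h => hz (congrFun h j)
      have h1 := preemptions_append_le hlen j (p j - S.amount phat p k j) σ
      have h2 : S.preemptions j (S.processed (S.phaseSegments proc phat p k) j)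
          (S.phaseSegments proc phat p k) ≤ c := by
        rw [hpr, phaseSegments, if_neg h0]
        exact (hproc _ (S.phaseRates_mem k) _ (S.phaseLength_pos hphat k)).preemptions_le j
      rw [hpr, sub_sub] at h1
      rw [hpr] at h2
      rw [if_pos hz, Finset.card_insert_of_notMem (by simp), mul_add_one]
      omega

end Problem

end PSP
end

universe u in
theorem mainTheorem4 (c : ℕ) :
    ∃ K : ℝ, 0 < K ∧
      ∀ (n : ℕ) (S : PSP.Problem.{u} n) (α : ℝ)
        (proc : (Fin n → ℝ) → ℝ → List (PSP.Segment S.Config)),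
        S.IsProcedure α c proc →
        ∀ ε : ℝ, 0 < ε →
          ∃ A : S.Algorithm,
            ∀ p phat : Fin n → ℝ, (∀ j, 0 < phat j ∧ phat j ≤ p j) →
              ∃ N : ℕ,
                S.finished p (S.schedule A phat p N) = Finset.univ ∧
                PSP.totalCompletionTime (S.rateAt (S.schedule A phat p N)) p ≤
                  ENNReal.ofReal (27 * α * (1 + ε)) * S.opt p ∧
                ((∑ j, S.preemptions j (p j) (S.schedule A phat p N) : ℕ) : ℝ) ≤
                  K * max 1 (1 / ε ^ 3) * ∑ j, (1 + Real.logb 2 (p j / phat j)) := by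
  have hl : 0 < Real.logb 2 (61 / 60) := Real.logb_pos (by norm_num) (by norm_num)
  have hK : 0 < (c + 1) * (1 + 1 / Real.logb 2 (61 / 60)) := by positivity
  refine ⟨_, hK, fun n S α proc hproc ε hε => ⟨S.phaseAlgorithm proc, fun p phat hpp => ?_⟩⟩
  have hphat : ∀ j, 0 < phat j := fun j => (hpp j).1
  have hp : ∀ j, phat j ≤ p j := fun j => (hpp j).2
  obtain ⟨m, hm⟩ := S.exists_alive_eq_empty hphat hp
  obtain ⟨N, hN, -⟩ := PSP.Problem.exists_schedule_eq_phaseSchedule hproc hphat hp m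
  refine ⟨N, ?_, ?_, ?_⟩
  · rw [hN, ← compl_inj_iff, PSP.Problem.compl_finished_phaseSchedule hproc hphat, hm]
    simp
  · rw [hN]
    refine (PSP.Problem.totalCompletionTime_phaseSchedule_le hproc hphat hm).trans ?_
    have hα := hproc.nonneg
    refine le_trans ?_ (mul_le_mul_right (S.ofReal_sum_phaseLength_mul_card_le_opt hphat hp hm) _)
    rw [← ENNReal.ofReal_mul (by positivity)]
    refine ENNReal.ofReal_le_ofReal ?_
    have h0 : 0 ≤ ∑ k ∈ Finset.range m, S.phaseLength phat k * (S.alive phat p k).card :=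
      Finset.sum_nonneg fun k _ => mul_nonneg (S.phaseLength_pos hphat k).le (Nat.cast_nonneg _)
    have := mul_nonneg (mul_nonneg hα hε.le) h0
    linarith
  · rw [hN]
    push_cast
    have hlog : ∀ j, 0 ≤ Real.logb 2 (p j / phat j) := fun j =>
      Real.logb_nonneg (by norm_num) ((one_le_div (hphat j)).2 (hp j))
    have hmax : (1 : ℝ) ≤ max 1 (1 / ε ^ 3) := le_max_left _ _
    refine le_trans ?_ (mul_le_mul_of_nonneg_right (le_mul_of_one_le_right hK.le hmax)
      (Finset.sum_nonneg fun j _ => by linarith [hlog j]))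
    rw [Finset.mul_sum]
    refine Finset.sum_le_sum fun j _ => ?_
    have h1 := PSP.Problem.preemptions_phaseSchedule_append_le (p := p) hproc hphat j m []
    rw [List.append_nil, PSP.Problem.preemptions, add_zero] at h1
    have h2 := (S.participations_mul_le hphat hp j m).1
    rw [← le_div_iff₀ hl, add_div, div_self hl.ne'] at h2
    have h3 : ((S.preemptions j (p j) (S.phaseSchedule proc phat p m) : ℕ) : ℝ) ≤
        (c + 1) * (((Finset.range m).filter fun i => S.phaseRates phat p i j ≠ 0).card : ℝ) := by
      exact_mod_cast h1
    refine h3.trans ?_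
    rw [mul_assoc]
    refine mul_le_mul_of_nonneg_left (h2.trans ?_) (by positivity)
    rw [add_mul, one_mul, div_mul_eq_mul_div, one_mul]
    linarith [hlog j]
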